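/- A \emph{stacked polyhedron} is a polyhedron in $\mathbb{R}^3$ with triangular faces that is obtained from a single non-degenerate tetrahedron by repeatedly gluing a non-degenerate tetrahedron onto a single triangular face $t$ of the polyhedron built so far; the new tetrahedron must meet that polyhedron exactly in $t$. In the final polyhedron, no two triangles that share an edge are coplanar, so that the triangles are really its faces. An \emph{edge unfolding} of such a polyhedron consists of a set of edges to be cut and an isometric placement of every face in the plane such that any two faces sharing an uncut edge agree along that edge, any two faces are joined by a chain of faces that crosses only uncut edges (the surface stays in one piece), and the interiors of the placed faces are pairwise disjoint. A \emph{stacked hat} on a triangular face $abc$ is obtained by successively gluing tetrahedra with apices $x,y,z,w$ onto the triangles $abc$, $cax$, $cxy$, $xyz$. It has nine triangles: three brim triangles $abx,bcx,cay$, three band triangles $axy,cyz,czx$, and three crown triangles $xyw,yzw,zxw$. Its crown triangles are required to be isosceles with apex $w$, and taller than the isosceles triangle inscribed in a regular pentagon (whose base is a side of the pentagon and whose apex is the opposite vertex); that is, the ratio of height to base exceeds $\tfrac12\tan 72^\circ$. \textbf{Theorem.} There exists a stacked polyhedron that has no edge unfolding. Moreover, it can be obtained from a regular tetrahedron by replacing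 each of the four faces with a stacked hat. -/

import Mathlib

/-- Euclidean 3-space. -/
abbrev E3 : Type := EuclideanSpace ℝ (Fin 3)

/-- The Euclidean plane. -/
abbrev E2 : Type := EuclideanSpace ℝ (Fin 2)

/-- The (solid) simplex spanned by a finite set of points: a triangle for three affinely independent
points, a tetrahedron for four. -/
abbrev hull (t : Finset E3) : Set E3 := convexHull ℝ (t : Set E3)

/-- The data of a polyhedron with triangular faces: the solid body, and its faces, each face being
given by the set of its three vertices. -/
structure TriPolyhedron where
  solid : Set E3
  faces : Finset (Finset E3)

namespace TriPolyhedron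

/-- The tetrahedron with vertex set `T`; its faces are the 3-element subsets of `T`. -/
def tetrahedron (T : Finset E3) : TriPolyhedron where
  solid := hull T
  faces := T.powersetCard 3

open scoped Classical in
/-- A tetrahedron with apex `v` can be glued onto the face `t` of `P`: it is non-degenerate and
it meets `P` exactly in the triangle `t`. -/
structure CanGlue (P : TriPolyhedron) (t : Finset E3) (v : E3) : Prop where
  face : t ∈ P.faces
  apex_notMem : v ∉ t
  nondegenerate : AffineIndependent ℝ (fun p : (insert v t : Finset E3) => (p : E3))
  inter_eq : hull (insert v t) ∩ P.solid = hull t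

open scoped Classical in
/-- The result of gluing the tetrahedron with base `t` and apex `v` onto `P`: the face `t`
disappears and the three other faces of the new tetrahedron appear. -/
noncomputable def glue (P : TriPolyhedron) (t : Finset E3) (v : E3) : TriPolyhedron where
  solid := P.solid ∪ hull (insert v t)
  faces := P.faces.erase t ∪ ((insert v t).powersetCard 3).erase t

/-- Stacked polyhedra: obtained from a single (non-degenerate) tetrahedron by repeatedly gluing a
tetrahedron onto a single triangular face. -/
inductive IsStacked : TriPolyhedron → Prop
  | tetrahedron (T : Finset E3) (hcard : T.card = 4)
      (hT : AffineIndependent ℝ (fun p : T => (p : E3))) : IsStacked (tetrahedron T)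
  | glue (P : TriPolyhedron) (t : Finset E3) (v : E3) (hP : IsStacked P)
      (hg : P.CanGlue t v) : IsStacked (P.glue t v)

open scoped Classical in
/-- `s` and `t` are two faces of `P` that share an edge (which is then `s ∩ t`). -/
def AdjFaces (P : TriPolyhedron) (s t : Finset E3) : Prop :=
  s ∈ P.faces ∧ t ∈ P.faces ∧ (s ∩ t).card = 2

open scoped Classical in
/-- Adjacent triangles are never coplanar, so that the triangles and their sides are really the
faces and edges of the polyhedron. -/
def NoFlatEdges (P : TriPolyhedron) : Prop :=
  ∀ s t, P.AdjFaces s t → ¬ Coplanar ℝ ((s ∪ t : Finset E3) : Set E3)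

/-- The edges of `P`, each given by the set of its two endpoints. -/
def edges (P : TriPolyhedron) : Set (Finset E3) :=
  {e | e.card = 2 ∧ ∃ t ∈ P.faces, e ⊆ t}

open scoped Classical in
/-- `place` is an unfolding of the surface of `P`, cut along the edges in `cut`, into a single
planar piece without overlap. Each face `t` is placed in the plane by `place t`, an affine map that
is an isometry on the face. -/
structure IsEdgeUnfolding (P : TriPolyhedron) (cut : Set (Finset E3))
    (place : Finset E3 → E3 →ᵃ[ℝ] E2) : Prop where
  /-- only edges are cut -/
  cut_subset : cut ⊆ P.edges
  /-- faces are placed rigidly -/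
  isometric : ∀ t ∈ P.faces, ∀ x ∈ hull t, ∀ y ∈ hull t,
    dist (place t x) (place t y) = dist x y
  /-- two faces remain attached along each uncut edge -/
  attached : ∀ s t, P.AdjFaces s t → s ∩ t ∉ cut → ∀ x ∈ hull (s ∩ t), place s x = place t x
  /-- the surface, after cutting, is a single piece: any two faces are joined by a chain of faces
  that crosses uncut edges only -/
  connected : ∀ s ∈ P.faces, ∀ t ∈ P.faces,
    Relation.ReflTransGen (fun s' t' => P.AdjFaces s' t' ∧ s' ∩ t' ∉ cut) s t
  /-- no two faces overlap in the plane -/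
  nonoverlapping : ∀ s ∈ P.faces, ∀ t ∈ P.faces, s ≠ t →
    Disjoint (interior (place s '' hull s)) (interior (place t '' hull t))

/-- `P` has an edge unfolding (a net). -/
def HasEdgeUnfolding (P : TriPolyhedron) : Prop :=
  ∃ cut place, P.IsEdgeUnfolding cut place

end TriPolyhedron

/-- The triangle with base `p q` and apex `w` is isosceles, with equal sides at `w`, and it is
taller, relative to its base, than the isosceles triangle inscribed in a regular pentagon (base a
side of the pentagon, apex the opposite vertex). The latter has base angles `2π/5`, so its height is
`tan (2π/5) / 2` times its base. -/
def IsTallIsosceles (w p q : E3) : Prop :=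
  dist w p = dist w q ∧
    Real.tan (2 * Real.pi / 5) / 2 * dist p q < dist w (midpoint ℝ p q)

open scoped Classical in
/-- `Q` arises from `P` by replacing the face `t = {a, b, c}` by a stacked hat, that is, by gluing
successively four tetrahedra with apices `x`, `y`, `z`, `w` onto `abc`, `cax`, `cxy`, `xyz`. The nine
triangles of the hat are the brim `abx`, `bcx`, `cay`, the band `axy`, `cyz`, `czx`, and the crown
`xyw`, `yzw`, `zxw`; the crown triangles are tall isosceles triangles with common apex `w`. -/
def ReplacesFaceByHat (P : TriPolyhedron) (t : Finset E3) (Q : TriPolyhedron) : Prop :=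
  ∃ a b c x y z w : E3, t = {a, b, c} ∧
    ∃ P₁ P₂ P₃ : TriPolyhedron,
      (P.CanGlue {a, b, c} x ∧ P₁ = P.glue {a, b, c} x) ∧
      (P₁.CanGlue {c, a, x} y ∧ P₂ = P₁.glue {c, a, x} y) ∧
      (P₂.CanGlue {c, x, y} z ∧ P₃ = P₂.glue {c, x, y} z) ∧
      (P₃.CanGlue {x, y, z} w ∧ Q = P₃.glue {x, y, z} w) ∧
      IsTallIsosceles w x y ∧ IsTallIsosceles w y z ∧ IsTallIsosceles w z x

/-- `p, q, r, s` are the vertices of a regular tetrahedron: all six edges have the same positive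
length. -/
def IsRegularTetrahedron (p q r s : E3) : Prop :=
  ∃ d : ℝ, 0 < d ∧ dist p q = d ∧ dist p r = d ∧ dist p s = d ∧
    dist q r = d ∧ dist q s = d ∧ dist r s = d

open scoped Classical in
/-- `Q` is obtained from a regular tetrahedron by replacing each of its four faces by a stacked
hat. -/
def IsHattedTetrahedron (Q : TriPolyhedron) : Prop :=
  ∃ p q r s : E3, IsRegularTetrahedron p q r s ∧
    ∃ P₁ P₂ P₃ : TriPolyhedron,
      ReplacesFaceByHat (TriPolyhedron.tetrahedron {p, q, r, s}) {q, r, s} P₁ ∧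
      ReplacesFaceByHat P₁ {p, r, s} P₂ ∧
      ReplacesFaceByHat P₂ {p, q, s} P₃ ∧
      ReplacesFaceByHat P₃ {p, q, r} Q

/-! At each of the vertices `x`, `y`, `z` of a hat, the face angles sum to more than `2π` even after
one crown triangle at that vertex is left out. Planar triangles with disjoint interiors around a
common point have angle sum at most `2π` (`sum_angle_le_two_pi`, by comparing areas in a small
disk). Hence in an unfolding at least two edges are cut at each of `x`, `y`, `z`, and the cuts there
are never just the two sides of one crown triangle (`not_fan_agree`).

This forces the cuts interior to a hat to disconnect it. Otherwise, with the boundary of the hat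
contracted to one point, the cut edges would form a forest. Its leaves could only be `w` and the
boundary point, so it would be a path from `w` to the boundary through all of `x`, `y`, `z`. The
path would leave `w` to some `u` and go on to another crown vertex `v`, so that the only cuts at `u`
would be the two sides `uw`, `uv` of a crown triangle, which is excluded. The formal proof replaces
this argument by a check of all sets of the twelve interior edges (`sideOrArc_eq_true`).

Each hat thus carries a nonconstant coloring of its nine triangles that does not change across uncut
interior edges. Rescaling and shifting these four colorings gives eight free parameters, while
agreement across the six edges of the tetrahedron imposes only six conditions. Besides the constant
colorings there is therefore a nonconstant one that does not change across any uncut edge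
(`exists_global_coloring`), so the surface falls apart.

It remains to exhibit coordinates. Integer points are chosen, so that gluing, nonflatness, tallness
and the angle bounds all reduce to decidable integer statements. -/

open MeasureTheory Set Filter Topology
open scoped Pointwise

/-! ### Angle sums at a point of the plane, by area. -/

/-- The open circular sector of radius `r` and opening angle `θ` at the origin. -/
def openSector (r θ : ℝ) : Set ℂ := Complex.polarCoord.symm '' (Ioo 0 r ×ˢ Ioo 0 θ)

theorem Ioo_prod_subset_polarCoord_target {r θ : ℝ} (hθ : θ ≤ Real.pi) :
    Ioo 0 r ×ˢ Ioo 0 θ ⊆ Complex.polarCoord.target := by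
  rintro ⟨ρ, φ⟩ ⟨h1, h2⟩
  simp only [Complex.polarCoord_target, mem_prod, mem_Ioi, mem_Ioo] at *
  refine ⟨h1.1, ?_, ?_⟩ <;> linarith [h2.1, h2.2, Real.pi_pos]

theorem isOpen_openSector {r θ : ℝ} (hθ : θ ≤ Real.pi) : IsOpen (openSector r θ) :=
  Complex.polarCoord.isOpen_image_symm_of_subset_target (isOpen_Ioo.prod isOpen_Ioo)
    (Ioo_prod_subset_polarCoord_target hθ)

theorem volume_openSector {r θ : ℝ} (hr : 0 ≤ r) (hθ : θ ≤ Real.pi) :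
    volume (openSector r θ) = ENNReal.ofReal (θ * r ^ 2 / 2) := by
  have hsub := Ioo_prod_subset_polarCoord_target (r := r) hθ
  have h := Complex.lintegral_comp_polarCoord_symm ((openSector r θ).indicator 1)
  rw [lintegral_indicator_one (isOpen_openSector hθ).measurableSet] at h
  rw [← h]
  have hR : MeasurableSet (Ioo 0 r ×ˢ Ioo 0 θ) := measurableSet_Ioo.prod measurableSet_Ioo
  have e1 : ∫⁻ p in polarCoord.target, ENNReal.ofReal p.1 •
        (openSector r θ).indicator 1 (Complex.polarCoord.symm p) =
      ∫⁻ p in polarCoord.target, (Ioo 0 r ×ˢ Ioo 0 θ).indicator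
        (fun p => ENNReal.ofReal p.1) p := by
    refine setLIntegral_congr_fun polarCoord.open_target.measurableSet ?_
    intro p hp
    beta_reduce
    have hp' : p ∈ Complex.polarCoord.target := by simpa [Complex.polarCoord_target] using hp
    by_cases hm : p ∈ Ioo 0 r ×ˢ Ioo 0 θ
    · have : Complex.polarCoord.symm p ∈ openSector r θ := mem_image_of_mem _ hm
      rw [indicator_of_mem hm, indicator_of_mem this]
      simp
    · have : Complex.polarCoord.symm p ∉ openSector r θ := by
        rintro ⟨q, hq, he⟩
        exact hm (Complex.polarCoord.symm.injOn (hsub hq) hp' he ▸ hq)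
      rw [indicator_of_notMem hm, indicator_of_notMem this]
      simp
  rw [e1, lintegral_indicator hR, Measure.restrict_restrict hR,
    inter_eq_left.2 (by simpa [Complex.polarCoord_target] using hsub),
    Measure.volume_eq_prod, ← Measure.prod_restrict,
    lintegral_prod _ (by fun_prop)]
  simp only [lintegral_const, Measure.restrict_apply, MeasurableSet.univ, univ_inter,
    Real.volume_Ioo, sub_zero]
  rw [lintegral_mul_const _ (by fun_prop), ← ofReal_integral_eq_lintegral_ofReal]
  · rw [← integral_Ioc_eq_integral_Ioo, ← intervalIntegral.integral_of_le hr, integral_id,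
      ← ENNReal.ofReal_mul (by linarith [sq_nonneg r])]
    congr 1
    ring
  · exact (continuous_id.integrableOn_Icc).mono_set Ioo_subset_Icc_self
  · exact (ae_restrict_iff' measurableSet_Ioo).2 (ae_of_all _ fun x hx => hx.1.le)

theorem mem_openSector {r θ : ℝ} {z : ℂ} (hz : z ∈ openSector r θ) :
    ∃ ρ φ : ℝ, 0 < ρ ∧ ρ < r ∧ 0 < φ ∧ φ < θ ∧
      z = ρ * (Real.cos φ + Real.sin φ * Complex.I) := by
  obtain ⟨⟨ρ, φ⟩, ⟨h1, h2⟩, rfl⟩ := hz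
  exact ⟨ρ, φ, h1.1, h1.2, h2.1, h2.2, by simp [Complex.polarCoord_symm_apply]⟩

/-- A triangle in the complex plane with a vertex at the origin contains, near the origin, an open
sector of the corresponding opening angle. -/
theorem exists_sector_of_arg_pos {p q : ℂ} (h0 : 0 < (q / p).arg) (hpi : (q / p).arg < Real.pi) :
    ∀ᶠ r in 𝓝[>] (0 : ℝ), ∃ S : Set ℂ, IsOpen S ∧
      volume S = ENNReal.ofReal ((q / p).arg * r ^ 2 / 2) ∧
      S ⊆ convexHull ℝ {0, p, q} ∧ S ⊆ Metric.ball 0 r := by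
  have hp : p ≠ 0 := by rintro rfl; simp at h0
  have hq : q ≠ 0 := by rintro rfl; simp at h0
  have hp' : 0 < ‖p‖ := norm_pos_iff.2 hp
  have hq' : 0 < ‖q‖ := norm_pos_iff.2 hq
  set θ := (q / p).arg with hθ
  have hs : 0 < Real.sin θ := Real.sin_pos_of_pos_of_lt_pi h0 hpi
  have hqp : q = p * ((‖q‖ / ‖p‖ : ℝ) * (Real.cos θ + Real.sin θ * Complex.I)) := by
    have := Complex.norm_mul_cos_add_sin_mul_I (q / p)
    rw [norm_div, ← hθ, ← Complex.ofReal_cos, ← Complex.ofReal_sin] at this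
    rw [this]; field_simp
  -- The coordinates of a point at distance `ρ` with respect to `p` and `q` sum to at most `ρ * k`,
  -- so radius `1 / k` keeps the sector inside the triangle.
  set k : ℝ := 1 / (‖p‖ * Real.sin θ) + 1 / (‖q‖ * Real.sin θ) with hk
  have hkpos : 0 < k := by positivity
  have hev : ∀ᶠ r in 𝓝[>] (0 : ℝ), r < 1 / k :=
    nhdsWithin_le_nhds (gt_mem_nhds (by positivity))
  filter_upwards [hev, self_mem_nhdsWithin] with r hr hr0
  have hr0 : 0 < r := hr0
  let u : Circle := ⟨p / ‖p‖, by simp [Submonoid.unitSphere, hp]⟩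
  refine ⟨rotation u '' openSector r θ, ?_, ?_, ?_, ?_⟩
  · exact (rotation u).toHomeomorph.isOpenMap _ (isOpen_openSector hpi.le)
  · have := (rotation u).measurePreserving.measure_preimage_equiv
      (f := (rotation u).toMeasurableEquiv) (rotation u '' openSector r θ)
    rw [← volume_openSector hr0.le hpi.le, ← this]
    congr 1
    exact (preimage_image_eq _ (rotation u).injective)
  · rintro _ ⟨z, hz, rfl⟩
    obtain ⟨ρ, φ, h1, h2, h3, h4, rfl⟩ := mem_openSector hz
    have s1 : 0 < Real.sin φ := Real.sin_pos_of_pos_of_lt_pi h3 (by linarith)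
    have s2 : 0 < Real.sin (θ - φ) := Real.sin_pos_of_pos_of_lt_pi (by linarith) (by linarith)
    -- By the law of sines, `l` and `m` are the coordinates of the rotated sector point in the basis
    -- `p`, `q`.
    set l := ρ * Real.sin (θ - φ) / (‖p‖ * Real.sin θ) with hl
    set m := ρ * Real.sin φ / (‖q‖ * Real.sin θ) with hm
    have l0 : 0 ≤ l := by positivity
    have m0 : 0 ≤ m := by positivity
    have hlm : l + m ≤ 1 := by
      have e1 : l ≤ ρ * (1 / (‖p‖ * Real.sin θ)) := by
        rw [hl, mul_one_div]
        gcongr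
        nlinarith [Real.sin_le_one (θ - φ)]
      have e2 : m ≤ ρ * (1 / (‖q‖ * Real.sin θ)) := by
        rw [hm, mul_one_div]
        gcongr
        nlinarith [Real.sin_le_one φ]
      have e3 : ρ * k ≤ 1 := by
        rw [lt_div_iff₀ hkpos] at hr
        nlinarith
      rw [hk, mul_add] at e3
      linarith
    have key : rotation u (ρ * (Real.cos φ + Real.sin φ * Complex.I)) =
        (1 - l - m) • (0 : ℂ) + l • p + m • q := by
      have hpc : (‖p‖ : ℂ) ≠ 0 := by exact_mod_cast hp'.ne'
      have hqc : (‖q‖ : ℂ) ≠ 0 := by exact_mod_cast hq'.ne'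
      have hsc : (Real.sin θ : ℂ) ≠ 0 := by exact_mod_cast hs.ne'
      rw [rotation_apply, smul_zero, zero_add, Complex.real_smul, Complex.real_smul]
      conv_rhs => rw [hqp]
      change p / ‖p‖ * _ = _
      rw [hl, hm, Real.sin_sub]
      push_cast
      push_cast at hsc
      field_simp
      ring
    rw [key]
    have := (convex_convexHull ℝ ({0, p, q} : Set ℂ)).sum_mem (t := Finset.univ)
      (w := ![1 - l - m, l, m]) (z := ![0, p, q]) ?_ ?_ ?_
    · simpa [Fin.sum_univ_three] using this
    · intro i _
      fin_cases i
      · simpa using by linarith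
      · simpa using l0
      · simpa using m0
    · simp only [Fin.sum_univ_three, Matrix.cons_val]
      ring
    · intro i _
      apply subset_convexHull
      fin_cases i <;> simp
  · rintro _ ⟨z, hz, rfl⟩
    obtain ⟨ρ, φ, h1, h2, h3, h4, rfl⟩ := mem_openSector hz
    have : ‖(Real.cos φ + Real.sin φ * Complex.I : ℂ)‖ = 1 := by
      rw [Complex.ofReal_cos, Complex.ofReal_sin, Complex.norm_cos_add_sin_mul_I]
    rw [mem_ball_zero_iff, LinearIsometryEquiv.norm_map, norm_mul, this]
    simpa [abs_of_pos h1] using h2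

/-- The unoriented angle is the argument of `p / q` or of `q / p`, whichever is positive, and the
triangle is symmetric in `p` and `q`. -/
theorem exists_sector_complex {p q : ℂ} (hp : p ≠ 0) (hq : q ≠ 0)
    (h0 : 0 < InnerProductGeometry.angle p q)
    (hpi : InnerProductGeometry.angle p q < Real.pi) :
    ∀ᶠ r in 𝓝[>] (0 : ℝ), ∃ S : Set ℂ, IsOpen S ∧
      volume S = ENNReal.ofReal (InnerProductGeometry.angle p q * r ^ 2 / 2) ∧
      S ⊆ convexHull ℝ {0, p, q} ∧ S ⊆ Metric.ball 0 r := by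
  have h := Complex.angle_eq_abs_arg hp hq
  rcases le_total 0 (p / q).arg with h' | h'
  · rw [abs_of_nonneg h'] at h
    rw [h] at h0 hpi ⊢
    have := exists_sector_of_arg_pos h0 hpi
    rwa [show ({0, p, q} : Set ℂ) = {0, q, p} by rw [pair_comm]]
  · rw [abs_of_nonpos h'] at h
    have h2 : (q / p).arg = -(p / q).arg := by
      rw [← inv_div, Complex.arg_inv, if_neg]
      intro h3
      linarith [Real.pi_pos]
    rw [← h2] at h
    rw [h] at h0 hpi ⊢
    exact exists_sector_of_arg_pos h0 hpi

/-- Near a vertex `u`, a nondegenerate planar triangle `u p q` fills a sector whose opening angle is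
the angle of the triangle at `u`. -/
theorem ofReal_angle_le_volume {u p q : E2} (hp : p ≠ u) (hq : q ≠ u)
    (h0 : 0 < EuclideanGeometry.angle p u q) (hpi : EuclideanGeometry.angle p u q < Real.pi) :
    ∀ᶠ r in 𝓝[>] (0 : ℝ), ENNReal.ofReal (EuclideanGeometry.angle p u q * r ^ 2 / 2) ≤
      volume (interior (convexHull ℝ {u, p, q}) ∩ Metric.ball u r) := by
  let J : ℂ ≃ₗᵢ[ℝ] E2 := Complex.orthonormalBasisOneI.repr
  obtain ⟨p', hp'⟩ := J.surjective (p - u)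
  obtain ⟨q', hq'⟩ := J.surjective (q - u)
  have hang : EuclideanGeometry.angle p u q = InnerProductGeometry.angle p' q' := by
    rw [EuclideanGeometry.angle, vsub_eq_sub, vsub_eq_sub, ← hp', ← hq']
    exact J.toLinearIsometry.angle_map p' q'
  rw [hang] at h0 hpi ⊢
  have hp0 : p' ≠ 0 := by
    rintro rfl
    exact hp (sub_eq_zero.1 (by rw [← hp', map_zero]))
  have hq0 : q' ≠ 0 := by
    rintro rfl
    exact hq (sub_eq_zero.1 (by rw [← hq', map_zero]))
  filter_upwards [exists_sector_complex hp0 hq0 h0 hpi] with r ⟨S, hS, hvol, hsub, hball⟩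
  have hsubset : u +ᵥ J '' S ⊆ interior (convexHull ℝ {u, p, q}) ∩ Metric.ball u r := by
    apply subset_inter
    · apply interior_maximal
      · have h1 : ({u, p, q} : Set E2) = u +ᵥ J '' {0, p', q'} := by
          rw [image_insert_eq, image_pair, map_zero, hp', hq', ← image_vadd, image_insert_eq,
            image_pair]
          simp
        have h2 : convexHull ℝ (u +ᵥ J '' {0, p', q'}) = u +ᵥ J '' convexHull ℝ {0, p', q'} := by
          rw [convexHull_vadd]
          congr 1
          exact (J.toLinearEquiv.toLinearMap.image_convexHull _).symm
        rw [h1, h2]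
        exact vadd_set_mono (image_mono hsub)
      · exact (J.toHomeomorph.isOpenMap _ hS).vadd u
    · rintro _ ⟨_, ⟨z, hz, rfl⟩, rfl⟩
      have := hball hz
      rw [mem_ball_zero_iff] at this
      simpa [vadd_eq_add] using this
  refine le_trans (le_of_eq ?_) (measure_mono hsubset)
  rw [measure_vadd, ← hvol]
  have := J.measurePreserving.measure_preimage_equiv (f := J.toMeasurableEquiv) (J '' S)
  rw [← this]
  congr 1
  exact (preimage_image_eq _ J.injective).symm

/-- The angles at a common vertex of planar triangles with disjoint interiors sum to at most a full
turn. -/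
theorem sum_angle_le_two_pi {ι : Type*} (s : Finset ι) (u : E2) (p q : ι → E2)
    (hp : ∀ i ∈ s, p i ≠ u) (hq : ∀ i ∈ s, q i ≠ u)
    (h0 : ∀ i ∈ s, 0 < EuclideanGeometry.angle (p i) u (q i))
    (hpi : ∀ i ∈ s, EuclideanGeometry.angle (p i) u (q i) < Real.pi)
    (hdisj : (s : Set ι).PairwiseDisjoint fun i => interior (convexHull ℝ {u, p i, q i})) :
    ∑ i ∈ s, EuclideanGeometry.angle (p i) u (q i) ≤ 2 * Real.pi := by
  have hev : ∀ᶠ r in 𝓝[>] (0 : ℝ), ∀ i ∈ s,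
      ENNReal.ofReal (EuclideanGeometry.angle (p i) u (q i) * r ^ 2 / 2) ≤
        volume (interior (convexHull ℝ {u, p i, q i}) ∩ Metric.ball u r) :=
    (Finset.eventually_all s).2 fun i hi =>
      ofReal_angle_le_volume (hp i hi) (hq i hi) (h0 i hi) (hpi i hi)
  obtain ⟨r, hr, hr0⟩ := (hev.and self_mem_nhdsWithin).exists
  have hr0 : 0 < r := hr0
  -- In one ball that is small enough for all triangles, the disjoint sectors have total area at
  -- most that of the disk.
  have key : ENNReal.ofReal (∑ i ∈ s, EuclideanGeometry.angle (p i) u (q i) * r ^ 2 / 2) ≤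
      ENNReal.ofReal (Real.pi * r ^ 2) := by
    calc ENNReal.ofReal (∑ i ∈ s, EuclideanGeometry.angle (p i) u (q i) * r ^ 2 / 2)
        = ∑ i ∈ s, ENNReal.ofReal (EuclideanGeometry.angle (p i) u (q i) * r ^ 2 / 2) :=
          ENNReal.ofReal_sum_of_nonneg fun i hi => by have := h0 i hi; positivity
      _ ≤ ∑ i ∈ s, volume (interior (convexHull ℝ {u, p i, q i}) ∩ Metric.ball u r) :=
          Finset.sum_le_sum hr
      _ = volume (⋃ i ∈ s, interior (convexHull ℝ {u, p i, q i}) ∩ Metric.ball u r) :=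
          (measure_biUnion_finset (fun i hi j hj hij =>
            (hdisj hi hj hij).mono inter_subset_left inter_subset_left)
            fun i _ => (isOpen_interior.inter Metric.isOpen_ball).measurableSet).symm
      _ ≤ volume (Metric.ball u r) := measure_mono (iUnion₂_subset fun i _ => inter_subset_right)
      _ = ENNReal.ofReal (Real.pi * r ^ 2) := by
          rw [EuclideanSpace.volume_ball_fin_two, ← ENNReal.ofReal_pow hr0.le,
            mul_comm Real.pi, ENNReal.ofReal_mul (by positivity)]
  rw [ENNReal.ofReal_le_ofReal_iff (by positivity), ← Finset.sum_div, ← Finset.sum_mul] at key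
  have : 0 < r ^ 2 := by positivity
  nlinarith

/-! ### Angle sums in an unfolding. -/

namespace TriPolyhedron.IsEdgeUnfolding
variable {P : TriPolyhedron} {cut : Set (Finset E3)} {place : Finset E3 → E3 →ᵃ[ℝ] E2}

theorem dist_place (h : P.IsEdgeUnfolding cut place) {t : Finset E3} (ht : t ∈ P.faces) {x y : E3}
    (hx : x ∈ t) (hy : y ∈ t) : dist (place t x) (place t y) = dist x y :=
  h.isometric t ht x (subset_convexHull ℝ _ hx) y (subset_convexHull ℝ _ hy)

/-- By polarization, the three side lengths determine the angle. -/
theorem angle_place (h : P.IsEdgeUnfolding cut place) {t : Finset E3} (ht : t ∈ P.faces)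
    {x y z : E3} (hx : x ∈ t) (hy : y ∈ t) (hz : z ∈ t) :
    EuclideanGeometry.angle (place t x) (place t y) (place t z) =
      EuclideanGeometry.angle x y z := by
  have h1 := h.dist_place ht hx hy
  have h2 := h.dist_place ht hz hy
  have h3 := h.dist_place ht hx hz
  simp only [dist_eq_norm] at h1 h2 h3
  simp only [EuclideanGeometry.angle, InnerProductGeometry.angle, vsub_eq_sub,
    real_inner_eq_norm_mul_self_add_norm_mul_self_sub_norm_sub_mul_self_div_two,
    sub_sub_sub_cancel_right, h1, h2, h3]

/-- If distinct faces with a common vertex `u` are placed so that their copies of `u` coincide, then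
their angles at `u` sum to at most a full turn. -/
theorem sum_angle_le (h : P.IsEdgeUnfolding cut place) {ι : Type*} (s : Finset ι)
    (F : ι → Finset E3) (u : E3) (p q : ι → E3) (hF : ∀ i ∈ s, F i ∈ P.faces)
    (hFi : ∀ i ∈ s, (F i : Set E3) = {u, p i, q i}) (hinj : Set.InjOn F s)
    (hp : ∀ i ∈ s, p i ≠ u) (hq : ∀ i ∈ s, q i ≠ u)
    (h0 : ∀ i ∈ s, 0 < EuclideanGeometry.angle (p i) u (q i))
    (hpi : ∀ i ∈ s, EuclideanGeometry.angle (p i) u (q i) < Real.pi)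
    (hu : ∀ i ∈ s, ∀ j ∈ s, place (F i) u = place (F j) u) :
    ∑ i ∈ s, EuclideanGeometry.angle (p i) u (q i) ≤ 2 * Real.pi := by
  rcases s.eq_empty_or_nonempty with rfl | ⟨j, hj⟩
  · simpa using Real.pi_pos.le
  have mu : ∀ i ∈ s, u ∈ F i := fun i hi => by
    rw [← Finset.mem_coe, hFi i hi]; simp
  have mp : ∀ i ∈ s, p i ∈ F i := fun i hi => by
    rw [← Finset.mem_coe, hFi i hi]; simp
  have mq : ∀ i ∈ s, q i ∈ F i := fun i hi => by
    rw [← Finset.mem_coe, hFi i hi]; simp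
  have hang : ∀ i ∈ s, EuclideanGeometry.angle (place (F i) (p i)) (place (F j) u)
      (place (F i) (q i)) = EuclideanGeometry.angle (p i) u (q i) := fun i hi => by
    rw [hu j hj i hi, h.angle_place (hF i hi) (mp i hi) (mu i hi) (mq i hi)]
  rw [← Finset.sum_congr rfl hang]
  apply sum_angle_le_two_pi
  · intro i hi e
    rw [hu j hj i hi, ← dist_eq_zero, h.dist_place (hF i hi) (mp i hi) (mu i hi),
      dist_eq_zero] at e
    exact hp i hi e
  · intro i hi e
    rw [hu j hj i hi, ← dist_eq_zero, h.dist_place (hF i hi) (mq i hi) (mu i hi),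
      dist_eq_zero] at e
    exact hq i hi e
  · intro i hi
    rw [hang i hi]
    exact h0 i hi
  · intro i hi
    rw [hang i hi]
    exact hpi i hi
  · have himg : ∀ i ∈ s, convexHull ℝ {place (F j) u, place (F i) (p i), place (F i) (q i)} =
        place (F i) '' hull (F i) := fun i hi => by
      rw [hull, AffineMap.image_convexHull, hFi i hi, image_insert_eq, image_pair, hu j hj i hi]
    intro i hi k hk hik
    simp only [Function.onFun]
    rw [himg i hi, himg k hk]
    exact h.nonoverlapping _ (hF i hi) _ (hF k hk) (hinj.ne hi hk hik)

end TriPolyhedron.IsEdgeUnfolding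

/-! ### Gluing certified by separating planes. -/

/-- The polyhedron with vertices `e i`, made of the tetrahedra in `L` and with the faces in `F`. -/
def realize {ι : Type*} (e : ι ↪ E3) (L : List (Finset ι)) (F : Finset (Finset ι)) :
    TriPolyhedron where
  solid := ⋃ T ∈ L, hull (T.map e)
  faces := F.map (Finset.mapEmbedding e).toEmbedding

section realize
variable {ι : Type*} (e : ι ↪ E3)

theorem mem_faces_realize {L : List (Finset ι)} {F : Finset (Finset ι)} {t : Finset ι} :
    t.map e ∈ (realize e L F).faces ↔ t ∈ F := by
  rw [realize, ← Finset.mem_map' (Finset.mapEmbedding e).toEmbedding]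
  rfl

open scoped Classical in
theorem powersetCard_map_mapEmbedding (n : ℕ) (t : Finset ι) :
    (t.map e).powersetCard n = (t.powersetCard n).map (Finset.mapEmbedding e).toEmbedding :=
  Finset.powersetCard_map e n t

theorem tetrahedron_map (T : Finset ι) :
    TriPolyhedron.tetrahedron (T.map e) = realize e [T] (T.powersetCard 3) := by
  simp [TriPolyhedron.tetrahedron, realize, powersetCard_map_mapEmbedding]

theorem glue_realize [DecidableEq ι] (L : List (Finset ι)) (F : Finset (Finset ι)) (t : Finset ι)
    (v : ι) :
    (realize e L F).glue (t.map e) (e v) =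
      realize e (insert v t :: L) (F.erase t ∪ ((insert v t).powersetCard 3).erase t) := by
  classical
  simp only [TriPolyhedron.glue, realize, TriPolyhedron.mk.injEq]
  constructor
  · rw [Set.union_comm]
    simp [Finset.map_insert]
  · rw [Finset.map_union, Finset.map_erase, Finset.map_erase, ← powersetCard_map_mapEmbedding,
      Finset.map_insert]
    rfl

/-- A point of the new tetrahedron is a combination of `v` and a point of the base; any positive
weight on `v` makes `l` positive there, whereas `l ≤ 0` on the hull of `T`. -/
theorem hull_insert_inter_subset {t T : Finset E3} {v : E3} (ht : t.Nonempty) (l : E3 →ᵃ[ℝ] ℝ)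
    (h1 : ∀ x ∈ t, 0 ≤ l x) (h2 : 0 < l v) (h3 : ∀ x ∈ T, l x ≤ 0) [DecidableEq E3] :
    hull (insert v t) ∩ hull T ⊆ hull t := by
  rintro x ⟨hx, hxT⟩
  have hxl : l x ≤ 0 := by
    have := convexHull_min (s := (T : Set E3)) (t := l ⁻¹' Iic 0) h3
      ((convex_Iic 0).affine_preimage l)
    exact this hxT
  rw [hull, Finset.coe_insert, convexHull_insert (by simpa using ht)] at hx
  obtain ⟨v', hv', y, hy, a, b, ha, hb, hab, rfl⟩ := mem_convexJoin.1 hx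
  obtain rfl : v' = v := hv'
  have hyl : 0 ≤ l y := by
    have := convexHull_min (s := (t : Set E3)) (t := l ⁻¹' Ici 0) h1
      ((convex_Ici 0).affine_preimage l)
    exact this hy
  rw [Convex.combo_affine_apply hab, smul_eq_mul, smul_eq_mul] at hxl
  obtain rfl : a = 0 := by
    by_contra hne
    have : 0 < a := lt_of_le_of_ne ha (Ne.symm hne)
    nlinarith [mul_pos this h2, mul_nonneg hb hyl]
  obtain rfl : b = 1 := by linarith
  simpa using hy

theorem affineIndependent_insert {s : Set E3} {v : E3}
    (hs : AffineIndependent ℝ (fun x : s => (x : E3))) (hv : v ∉ affineSpan ℝ s) :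
    AffineIndependent ℝ (fun x : (insert v s : Set E3) => (x : E3)) := by
  refine AffineIndependent.affineIndependent_of_notMem_span (i := ⟨v, mem_insert v s⟩) ?_ ?_
  · let f : {y : (insert v s : Set E3) // y ≠ ⟨v, mem_insert v s⟩} ↪ s :=
      ⟨fun y => ⟨y.1.1, y.1.2.resolve_left fun h => y.2 (Subtype.ext h)⟩, fun y z h => by
        simpa [Subtype.ext_iff] using h⟩
    exact hs.comp_embedding f
  · intro h
    refine hv (affineSpan_mono ℝ ?_ h)
    rintro _ ⟨y, hy, rfl⟩
    exact y.2.resolve_left fun h => hy (Subtype.ext h)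

/-- A new tetrahedron that is separated by a plane from each tetrahedron of the polyhedron can be
glued on. -/
theorem canGlue_realize [DecidableEq ι] {L : List (Finset ι)} {F : Finset (Finset ι)}
    {t : Finset ι} {v : ι}
    (hL : ∀ T ∈ L, AffineIndependent ℝ (fun p : (T.map e : Finset E3) => (p : E3)))
    (htF : t ∈ F) (hne : t.Nonempty) (hv : v ∉ t) (htL : ∃ T ∈ L, t ⊆ T)
    (hsep : ∀ T ∈ L, ∃ l : E3 →ᵃ[ℝ] ℝ,
      (∀ i ∈ t, 0 ≤ l (e i)) ∧ 0 < l (e v) ∧ ∀ i ∈ T, l (e i) ≤ 0) :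
    (realize e L F).CanGlue (t.map e) (e v) ∧
      AffineIndependent ℝ (fun p : ((insert v t).map e : Finset E3) => (p : E3)) := by
  classical
  obtain ⟨T, hT, htT⟩ := htL
  have hind : AffineIndependent ℝ (fun p : ((insert v t).map e : Finset E3) => (p : E3)) := by
    obtain ⟨l, h1, h2, h3⟩ := hsep T hT
    have hT' : AffineIndependent ℝ (fun p : ((T.map e : Finset E3) : Set E3) => (p : E3)) :=
      hL T hT
    have ht' := hT'.mono (s := ((t.map e : Finset E3) : Set E3))
      (by simpa using Set.image_mono (f := e) htT)
    -- Since `t ⊆ T`, the two sign conditions squeeze `l` to zero on the base, so `0 < l (e v)` puts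
    -- the apex off its plane.
    have hl : ∀ x ∈ affineSpan ℝ ((t.map e : Finset E3) : Set E3), l x = 0 := by
      intro x hx
      have : affineSpan ℝ ((t.map e : Finset E3) : Set E3) ≤
          (affineSpan ℝ {(0 : ℝ)}).comap l := by
        rw [affineSpan_le]
        intro y hy
        obtain ⟨i, hi, rfl⟩ := Finset.mem_map.1 hy
        have := le_antisymm (h3 i (htT hi)) (h1 i hi)
        simp [this]
      simpa using this hx
    have hvn : e v ∉ affineSpan ℝ ((t.map e : Finset E3) : Set E3) := fun hx => by
      rw [hl _ hx] at h2
      exact lt_irrefl _ h2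
    have := affineIndependent_insert ht' hvn
    rw [Finset.map_insert]
    rwa [← Finset.coe_insert] at this
  have hins : insert (e v) (t.map e) = (insert v t).map e := by rw [Finset.map_insert]
  have hsubT : hull (t.map e) ⊆ hull (T.map e) :=
    convexHull_mono (Finset.coe_subset.2 (Finset.map_subset_map.2 htT))
  refine ⟨⟨(mem_faces_realize e).2 htF, by simpa using hv, ?_, ?_⟩, hind⟩
  · rw [← hins] at hind
    convert hind
  · apply subset_antisymm
    · rintro x ⟨hx, hxL⟩
      simp only [realize, mem_iUnion] at hxL
      obtain ⟨T', hT', hxT'⟩ := hxL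
      obtain ⟨l, h1, h2, h3⟩ := hsep T' hT'
      exact hull_insert_inter_subset (by simpa using hne) l (by simpa using h1) h2
        (by simpa using h3) ⟨hx, hxT'⟩
    · refine subset_inter (convexHull_mono ?_) ?_
      · simp
      · exact hsubT.trans (subset_iUnion₂ (s := fun (T : Finset ι) (_ : T ∈ L) => hull (T.map e)) T hT)

end realize

/-! ### The integer model. -/

/-- Integer coordinates of the vertices: first those of the regular tetrahedron, then, hat by hat,
the apices `x`, `y`, `z`, `w` of the four hats. -/
def coord : Fin 20 → Fin 3 → ℤ :=
  -- The tetrahedron sits on alternate vertices of a cube. The half-turns about the coordinate axes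
  -- preserve it and carry the first hat to the other three.
  ![![-7, -7, -7], ![-7, 7, 7], ![7, -7, 7], ![7, 7, -7],
    ![4, 6, -2], ![6, 5, -3], ![5, 4, -1], ![9, 9, 2],
    ![4, -6, 2], ![6, -5, 3], ![5, -4, 1], ![9, -9, -2],
    ![-4, 6, 2], ![-6, 5, 3], ![-5, 4, 1], ![-9, 9, -2],
    ![-4, -6, -2], ![-6, -5, -3], ![-5, -4, -1], ![-9, -9, 2]]

theorem coord_injective : Function.Injective coord := by decide +kernel

/-- The vertices. -/
noncomputable def vertex : Fin 20 ↪ E3 where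
  toFun i := WithLp.toLp 2 fun j => (coord i j : ℝ)
  inj' i k h := coord_injective <| funext fun j => by
    have := congrFun (WithLp.toLp_injective 2 h) j
    exact_mod_cast this

theorem vertex_apply (i : Fin 20) (j : Fin 3) : vertex i j = coord i j := rfl

/-- The inner product of `vertex i - vertex j` and `vertex k - vertex j`. -/
def dotAt (i j k : Fin 20) : ℤ :=
  (coord i 0 - coord j 0) * (coord k 0 - coord j 0) +
    (coord i 1 - coord j 1) * (coord k 1 - coord j 1) +
    (coord i 2 - coord j 2) * (coord k 2 - coord j 2)

theorem inner_vertex (i j k : Fin 20) :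
    inner ℝ (vertex i - vertex j) (vertex k - vertex j) = dotAt i j k := by
  simp [PiLp.inner_apply, Fin.sum_univ_three, vertex_apply, dotAt]
  ring

theorem dist_vertex_sq (i j : Fin 20) : dist (vertex i) (vertex j) ^ 2 = dotAt i j i := by
  rw [dist_eq_norm, ← inner_vertex, real_inner_self_eq_norm_sq]

/-- The affine functional with integer coefficients `c`. -/
noncomputable def intFunctional (c : ℤ × ℤ × ℤ × ℤ) : E3 →ᵃ[ℝ] ℝ :=
  ((c.1 : ℝ) • (EuclideanSpace.proj (𝕜 := ℝ) (0 : Fin 3)).toLinearMap +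
    (c.2.1 : ℝ) • (EuclideanSpace.proj (𝕜 := ℝ) (1 : Fin 3)).toLinearMap +
    (c.2.2.1 : ℝ) • (EuclideanSpace.proj (𝕜 := ℝ) (2 : Fin 3)).toLinearMap).toAffineMap +
    AffineMap.const ℝ E3 (c.2.2.2 : ℝ)

/-- The value of `intFunctional c` at `vertex i`. -/
def evalAt (c : ℤ × ℤ × ℤ × ℤ) (i : Fin 20) : ℤ :=
  c.1 * coord i 0 + c.2.1 * coord i 1 + c.2.2.1 * coord i 2 + c.2.2.2

theorem intFunctional_vertex (c : ℤ × ℤ × ℤ × ℤ) (i : Fin 20) :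
    intFunctional c (vertex i) = evalAt c i := by
  simp [intFunctional, evalAt, vertex_apply]

/-- The planes of the bases of the sixteen glued tetrahedra. -/
def basePlanes : List (ℤ × ℤ × ℤ × ℤ) :=
  [(1, 1, 1, -7), (4, 3, 3, -28), (22, 21, 23, -168), (1, 1, 1, -8),
    (1, -1, -1, -7), (4, -3, -3, -28), (22, -21, -23, -168), (1, -1, -1, -8),
    (-1, 1, -1, -7), (-4, 3, -3, -28), (-22, 21, -23, -168), (-1, 1, -1, -8),
    (-1, -1, 1, -7), (-4, -3, 3, -28), (-22, -21, 23, -168), (-1, -1, 1, -8)]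

/-- A combinatorial description of a polyhedron: the list of its tetrahedra and the set of its
faces. -/
abbrev Scheme : Type := List (Finset (Fin 20)) × Finset (Finset (Fin 20))

namespace Scheme

/-- The polyhedron described by a scheme. -/
noncomputable def toPolyhedron (S : Scheme) : TriPolyhedron := realize vertex S.1 S.2

/-- Gluing a tetrahedron with base `t` and apex `v`. -/
def glue (S : Scheme) (t : Finset (Fin 20)) (v : Fin 20) : Scheme :=
  (insert v t :: S.1, S.2.erase t ∪ ((insert v t).powersetCard 3).erase t)

/-- A sufficient criterion for gluing to be possible. -/
def Admissible (S : Scheme) (t : Finset (Fin 20)) (v : Fin 20) : Prop :=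
  t ∈ S.2 ∧ t.Nonempty ∧ v ∉ t ∧ (∃ T ∈ S.1, t ⊆ T) ∧
    -- The separating plane may depend on `T` and need not be the plane of the base `t`.
    ∀ T ∈ S.1, ∃ c ∈ basePlanes,
      (∀ i ∈ t, 0 ≤ evalAt c i) ∧ 0 < evalAt c v ∧ ∀ i ∈ T, evalAt c i ≤ 0

instance (S : Scheme) (t : Finset (Fin 20)) (v : Fin 20) : Decidable (S.Admissible t v) :=
  haveI : Decidable (∃ T ∈ S.1, t ⊆ T) := List.decidableBEx _ _
  haveI : Decidable (∀ T ∈ S.1, ∃ c ∈ basePlanes,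
      (∀ i ∈ t, 0 ≤ evalAt c i) ∧ 0 < evalAt c v ∧ ∀ i ∈ T, evalAt c i ≤ 0) :=
    List.decidableBAll _ _
  inferInstanceAs (Decidable (_ ∧ _ ∧ _ ∧ _ ∧ _))

/-- The scheme describes a stacked polyhedron, built from nondegenerate tetrahedra. -/
structure Good (S : Scheme) : Prop where
  isStacked : S.toPolyhedron.IsStacked
  affineIndependent : ∀ T ∈ S.1,
    AffineIndependent ℝ (fun p : (T.map vertex : Finset E3) => (p : E3))

theorem toPolyhedron_glue (S : Scheme) (t : Finset (Fin 20)) (v : Fin 20) :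
    (S.glue t v).toPolyhedron = S.toPolyhedron.glue (t.map vertex) (vertex v) :=
  (glue_realize vertex S.1 S.2 t v).symm

theorem Good.glue {S : Scheme} (hS : S.Good) {t : Finset (Fin 20)} {v : Fin 20}
    (h : S.Admissible t v) :
    S.toPolyhedron.CanGlue (t.map vertex) (vertex v) ∧ (S.glue t v).Good := by
  obtain ⟨h1, h2, h3, h4, h5⟩ := h
  have := canGlue_realize vertex (L := S.1) (F := S.2) hS.affineIndependent h1 h2 h3 h4
    fun T hT => by
      obtain ⟨c, -, c1, c2, c3⟩ := h5 T hT
      refine ⟨intFunctional c, fun i hi => ?_, ?_, fun i hi => ?_⟩ <;>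
        rw [intFunctional_vertex]
      · exact_mod_cast c1 i hi
      · exact_mod_cast c2
      · exact_mod_cast c3 i hi
  refine ⟨this.1, ⟨?_, ?_⟩⟩
  · rw [toPolyhedron_glue]
    exact .glue _ _ _ hS.isStacked this.1
  · intro T hT
    rcases List.mem_cons.1 hT with rfl | hT
    · exact this.2
    · exact hS.affineIndependent T hT

/-- The vertices `a`, `b`, `c`, `x`, `y`, `z`, `w` of the four hats. -/
def hatVertex : Fin 4 → Fin 7 → Fin 20 :=
  ![![3, 1, 2, 4, 5, 6, 7], ![2, 0, 3, 8, 9, 10, 11], ![1, 3, 0, 12, 13, 14, 15],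
    ![0, 2, 1, 16, 17, 18, 19]]

/-- The base of the `n`-th tetrahedron of the hat `h`. -/
def hatBase (h : Fin 4) : ℕ → Finset (Fin 20)
  | 0 => {hatVertex h 0, hatVertex h 1, hatVertex h 2}
  | 1 => {hatVertex h 2, hatVertex h 0, hatVertex h 3}
  | 2 => {hatVertex h 2, hatVertex h 3, hatVertex h 4}
  | _ => {hatVertex h 3, hatVertex h 4, hatVertex h 5}

/-- The apex of the `n`-th tetrahedron of the hat `h`. -/
def hatApex (h : Fin 4) : ℕ → Fin 20
  | 0 => hatVertex h 3
  | 1 => hatVertex h 4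
  | 2 => hatVertex h 5
  | _ => hatVertex h 6

/-- The first `n` gluings of the hat `h`. -/
def partialHat (S : Scheme) (h : Fin 4) : ℕ → Scheme
  | 0 => S
  | n + 1 => (partialHat S h n).glue (hatBase h n) (hatApex h n)

/-- The four gluings of the hat `h` are possible. -/
abbrev HatAdmissible (S : Scheme) (h : Fin 4) : Prop :=
  ∀ n < 4, (S.partialHat h n).Admissible (hatBase h n) (hatApex h n)

end Scheme

/-! ### Tallness of the crowns and the chain of gluings. -/

theorem tan_two_pi_div_five_le : Real.tan (2 * Real.pi / 5) ≤ 4 := by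
  have h5 : Real.sqrt 5 ^ 2 = 5 := Real.sq_sqrt (by norm_num)
  have hs : 2 ≤ Real.sqrt 5 := Real.le_sqrt_of_sq_le (by norm_num)
  have hc : Real.cos (2 * Real.pi / 5) = (Real.sqrt 5 - 1) / 4 := by
    rw [show 2 * Real.pi / 5 = 2 * (Real.pi / 5) by ring, Real.cos_two_mul, Real.cos_pi_div_five]
    linear_combination h5 / 8
  rw [Real.tan_eq_sin_div_cos, hc, div_le_iff₀ (by linarith)]
  linarith [Real.sin_le_one (2 * Real.pi / 5)]

/-- As the tangent is at most 4, a height above twice the base suffices. By Pythagoras the squared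
leg is the squared height plus a quarter of the squared base, hence the factor `17 / 4 = 4 + 1 / 4`.
-/
theorem isTallIsosceles_vertex {w p q : Fin 20} (h1 : dotAt w p w = dotAt w q w)
    (h2 : 17 * dotAt p q p < 4 * dotAt w p w) :
    IsTallIsosceles (vertex w) (vertex p) (vertex q) := by
  have e1 := dist_vertex_sq w p
  have e2 := dist_vertex_sq w q
  have e3 := dist_vertex_sq p q
  have h1' : (dotAt w p w : ℝ) = dotAt w q w := by exact_mod_cast h1
  have h2' : (17 * dotAt p q p : ℝ) < 4 * dotAt w p w := by exact_mod_cast h2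
  constructor
  · rw [← sq_eq_sq₀ dist_nonneg dist_nonneg, e1, e2, h1']
  · have hm := EuclideanGeometry.dist_sq_add_dist_sq_eq_two_mul_dist_midpoint_sq_add_half_dist_sq
      (vertex w) (vertex p) (vertex q)
    have : 2 * dist (vertex p) (vertex q) < dist (vertex w) (midpoint ℝ (vertex p) (vertex q)) := by
      refine lt_of_pow_lt_pow_left₀ 2 dist_nonneg ?_
      nlinarith
    have h0 : 0 ≤ dist (vertex p) (vertex q) := dist_nonneg
    nlinarith [tan_two_pi_div_five_le]

namespace Scheme

theorem hatVertex_tall (h : Fin 4) :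
    IsTallIsosceles (vertex (hatVertex h 6)) (vertex (hatVertex h 3)) (vertex (hatVertex h 4)) ∧
    IsTallIsosceles (vertex (hatVertex h 6)) (vertex (hatVertex h 4)) (vertex (hatVertex h 5)) ∧
    IsTallIsosceles (vertex (hatVertex h 6)) (vertex (hatVertex h 5)) (vertex (hatVertex h 3)) := by
  refine ⟨?_, ?_, ?_⟩ <;> apply isTallIsosceles_vertex <;> revert h <;> decide +kernel

open scoped Classical in
theorem map_triple (i j k : Fin 20) :
    ({i, j, k} : Finset (Fin 20)).map vertex = {vertex i, vertex j, vertex k} := by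
  simp [Finset.map_insert]

open scoped Classical in
theorem Good.hat {S : Scheme} (hS : S.Good) {h : Fin 4} (hh : S.HatAdmissible h)
    {t : Finset E3}
    (ht : t = {vertex (hatVertex h 0), vertex (hatVertex h 1), vertex (hatVertex h 2)}) :
    ReplacesFaceByHat S.toPolyhedron t (S.partialHat h 4).toPolyhedron ∧
      (S.partialHat h 4).Good := by
  have key : ∀ n ≤ 4, (S.partialHat h n).Good := by
    intro n
    induction n with
    | zero => exact fun _ => hS
    | succ n ih => exact fun hn => ((ih (by omega)).glue (hh n (by omega))).2
  have c : ∀ n < 4, (S.partialHat h n).toPolyhedron.CanGlue _ _ :=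
    fun n hn => ((key n hn.le).glue (hh n hn)).1
  have e : ∀ n, (S.partialHat h (n + 1)).toPolyhedron = _ :=
    fun n => toPolyhedron_glue (S.partialHat h n) (hatBase h n) (hatApex h n)
  refine ⟨⟨_, _, _, _, _, _, _, ht, (S.partialHat h 1).toPolyhedron,
    (S.partialHat h 2).toPolyhedron, (S.partialHat h 3).toPolyhedron, ⟨?_, ?_⟩, ⟨?_, ?_⟩,
    ⟨?_, ?_⟩, ⟨?_, ?_⟩, hatVertex_tall h⟩, key 4 le_rfl⟩ <;> simp only [← map_triple]
  · exact c 0 (by norm_num)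
  · exact e 0
  · exact c 1 (by norm_num)
  · exact e 1
  · exact c 2 (by norm_num)
  · exact e 2
  · exact c 3 (by norm_num)
  · exact e 3

/-- The tetrahedron with the first `n` hats. -/
def hatted : ℕ → Scheme
  | 0 => ([{0, 1, 2, 3}], ({0, 1, 2, 3} : Finset (Fin 20)).powersetCard 3)
  | n + 1 => (hatted n).partialHat (Fin.ofNat 4 n) 4

theorem hatAdmissible_hatted : ∀ n < 4, (hatted n).HatAdmissible (Fin.ofNat 4 n) := by
  decide +kernel

end Scheme

/-! ### Nondegeneracy, and the construction from the regular tetrahedron. -/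

/-- Six times the signed volume of a tetrahedron. -/
def volAt (i j k l : Fin 20) : ℤ :=
  Matrix.det (Matrix.of ![fun m => coord j m - coord i m, fun m => coord k m - coord i m,
    fun m => coord l m - coord i m])

theorem affineIndependent_vertex {i j k l : Fin 20} (h : volAt i j k l ≠ 0) :
    AffineIndependent ℝ ![vertex i, vertex j, vertex k, vertex l] := by
  rw [affineIndependent_iff_linearIndependent_vsub ℝ _ 0,
    ← linearIndependent_equiv (finSuccAboveEquiv (0 : Fin 4))]
  apply LinearIndependent.of_comp (WithLp.linearEquiv 2 ℝ (Fin 3 → ℝ)).toLinearMap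
  have := Matrix.linearIndependent_rows_of_det_ne_zero (A := (Matrix.of
    ![fun m => coord j m - coord i m, fun m => coord k m - coord i m,
    fun m => coord l m - coord i m]).map (Int.cast : ℤ → ℝ)) (by
      rw [show Matrix.map _ Int.cast = (Int.castRingHom ℝ).mapMatrix _ from rfl, ← RingHom.map_det,
        eq_intCast, Int.cast_ne_zero]
      exact h)
  convert this using 1
  · ext a m
    fin_cases a <;> simp [finSuccAboveEquiv_apply, vertex_apply]
  · rfl
  · rfl

theorem not_coplanar_of_volAt {s : Set E3} {i j k l : Fin 20} (h : volAt i j k l ≠ 0)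
    (hi : vertex i ∈ s) (hj : vertex j ∈ s) (hk : vertex k ∈ s) (hl : vertex l ∈ s) :
    ¬ Coplanar ℝ s := fun hc => by
  have h1 : Coplanar ℝ (Set.range ![vertex i, vertex j, vertex k, vertex l]) := by
    refine hc.subset ?_
    rintro _ ⟨a, rfl⟩
    fin_cases a <;> assumption
  have h2 := (affineIndependent_vertex h).finrank_vectorSpan (n := 3) (by simp)
  rw [coplanar_iff_finrank_le_two] at h1
  omega

namespace Scheme

theorem good_hatted_zero : (hatted 0).Good := by
  have hind : AffineIndependent ℝ
      (fun p : ((({0, 1, 2, 3} : Finset (Fin 20)).map vertex : Finset E3)) => (p : E3)) := by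
    have := (affineIndependent_vertex (i := 0) (j := 1) (k := 2) (l := 3) (by decide +kernel)).range
    have hr : Set.range ![vertex 0, vertex 1, vertex 2, vertex 3] =
        ((({0, 1, 2, 3} : Finset (Fin 20)).map vertex : Finset E3) : Set E3) := by
      ext x
      simp [Matrix.range_cons]
      tauto
    rw [hr] at this
    exact this
  refine ⟨?_, ?_⟩
  · rw [toPolyhedron, hatted, ← tetrahedron_map]
    exact .tetrahedron _ (by simp) hind
  · intro T hT
    obtain rfl := List.mem_singleton.1 hT
    exact hind

theorem good_hatted : ∀ n ≤ 4, (hatted n).Good := by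
  intro n
  induction n with
  | zero => exact fun _ => good_hatted_zero
  | succ n ih => exact fun hn => ((ih (by omega)).hat (hatAdmissible_hatted n (by omega)) rfl).2

theorem replacesFaceByHat_hatted {n : ℕ} (hn : n < 4) {i j k : Fin 20}
    (h : ({i, j, k} : Finset (Fin 20)) = hatBase (Fin.ofNat 4 n) 0) {t : Finset E3}
    (ht : t = ({i, j, k} : Finset (Fin 20)).map vertex) :
    ReplacesFaceByHat (hatted n).toPolyhedron t (hatted (n + 1)).toPolyhedron :=
  ((good_hatted n hn.le).hat (hatAdmissible_hatted n hn) (by rw [ht, h, ← map_triple]; rfl)).1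

theorem isRegularTetrahedron_vertex :
    IsRegularTetrahedron (vertex 0) (vertex 1) (vertex 2) (vertex 3) := by
  have key : ∀ i j : Fin 20, dotAt i j i = 392 → dist (vertex i) (vertex j) = Real.sqrt 392 := by
    intro i j h
    rw [← Real.sqrt_sq (dist_nonneg (x := vertex i)), dist_vertex_sq, h]
    norm_num
  refine ⟨Real.sqrt 392, by positivity, ?_, ?_, ?_, ?_, ?_, ?_⟩ <;> apply key <;> decide +kernel

theorem isHattedTetrahedron_hatted : IsHattedTetrahedron (hatted 4).toPolyhedron := by
  classical
  have h0 : (hatted 0).toPolyhedron =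
      TriPolyhedron.tetrahedron {vertex 0, vertex 1, vertex 2, vertex 3} := by
    rw [toPolyhedron, hatted, ← tetrahedron_map]
    simp [Finset.map_insert]
  refine ⟨_, _, _, _, isRegularTetrahedron_vertex, (hatted 1).toPolyhedron,
    (hatted 2).toPolyhedron, (hatted 3).toPolyhedron, ?_, ?_, ?_, ?_⟩
  · convert replacesFaceByHat_hatted (n := 0) (i := 1) (j := 2) (k := 3) (by norm_num)
      (by decide +kernel) (map_triple _ _ _).symm using 1
    exact h0.symm
  · exact replacesFaceByHat_hatted (n := 1) (i := 0) (j := 2) (k := 3) (by norm_num)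
      (by decide +kernel) (map_triple _ _ _).symm
  · exact replacesFaceByHat_hatted (n := 2) (i := 0) (j := 1) (k := 3) (by norm_num)
      (by decide +kernel) (map_triple _ _ _).symm
  · exact replacesFaceByHat_hatted (n := 3) (i := 0) (j := 1) (k := 2) (by norm_num)
      (by decide +kernel) (map_triple _ _ _).symm

end Scheme

/-! ### The 36 faces and the absence of flat edges. -/

/-- The vertices of the nine triangles of a hat, as indices into `Scheme.hatVertex`. -/
def hatTriangle : Fin 9 → Fin 7 × Fin 7 × Fin 7 :=
  ![(0, 1, 3), (1, 2, 3), (2, 0, 4), (0, 3, 4), (2, 4, 5), (2, 5, 3), (3, 4, 6), (4, 5, 6),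
    (5, 3, 6)]

/-- The triangle `i` of the hat `h`. -/
def hatFace (h : Fin 4) (i : Fin 9) : Finset (Fin 20) :=
  {Scheme.hatVertex h (hatTriangle i).1, Scheme.hatVertex h (hatTriangle i).2.1,
    Scheme.hatVertex h (hatTriangle i).2.2}

theorem hatted_faces : (Scheme.hatted 4).2 =
    (Finset.univ : Finset (Fin 4 × Fin 9)).image fun x => hatFace x.1 x.2 := by
  decide +kernel

theorem exists_volAt_ne_zero : ∀ h h' : Fin 4, ∀ i i' : Fin 9,
    (hatFace h i ∩ hatFace h' i').card = 2 →
    ∃ a ∈ hatFace h i, ∃ b ∈ hatFace h i, ∃ c ∈ hatFace h i, ∃ d ∈ hatFace h' i',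
      volAt a b c d ≠ 0 := by
  decide +kernel

theorem noFlatEdges_hatted : (Scheme.hatted 4).toPolyhedron.NoFlatEdges := by
  classical
  rintro s t ⟨hs, ht, hst⟩
  simp only [Scheme.toPolyhedron, realize, hatted_faces, Finset.mem_map, Finset.mem_image,
    Finset.mem_univ, true_and] at hs ht
  obtain ⟨_, ⟨⟨h, i⟩, rfl⟩, rfl⟩ := hs
  obtain ⟨_, ⟨⟨h', i'⟩, rfl⟩, rfl⟩ := ht
  change ((hatFace h i).map vertex ∩ (hatFace h' i').map vertex).card = 2 at hst
  rw [← Finset.map_inter, Finset.card_map] at hst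
  obtain ⟨a, ha, b, hb, c, hc, d, hd, hv⟩ := exists_volAt_ne_zero h h' i i' hst
  refine not_coplanar_of_volAt hv ?_ ?_ ?_ ?_ <;> rw [Finset.mem_coe, Finset.mem_union]
  · exact .inl (Finset.mem_map_of_mem _ ha)
  · exact .inl (Finset.mem_map_of_mem _ hb)
  · exact .inl (Finset.mem_map_of_mem _ hc)
  · exact .inr (Finset.mem_map_of_mem _ hd)

/-! ### Angle bounds at the crown vertices. -/

/-- A lower bound for `100000 * cos (k * π / 12)`, for those `k` that are needed. -/
def cosBound : ℕ → ℤ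
  | 1 => 96592
  | 2 => 86602
  | 3 => 70710
  | 5 => 25881
  | 7 => -25882
  | 9 => -70711
  | 10 => -86603
  | _ => -100000

theorem cosBound_le (k : ℕ) : (cosBound k : ℝ) / 100000 ≤ Real.cos (k * Real.pi / 12) := by
  have h2 : Real.sqrt 2 ^ 2 = 2 := Real.sq_sqrt (by norm_num)
  have h3 : Real.sqrt 3 ^ 2 = 3 := Real.sq_sqrt (by norm_num)
  have l2 : 1.414213 ≤ Real.sqrt 2 := Real.le_sqrt_of_sq_le (by norm_num)
  have l3 : 1.732050 ≤ Real.sqrt 3 := Real.le_sqrt_of_sq_le (by norm_num)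
  have u2 : Real.sqrt 2 ≤ 1.414214 := Real.sqrt_le_iff.2 (by norm_num)
  have u3 : Real.sqrt 3 ≤ 1.732051 := Real.sqrt_le_iff.2 (by norm_num)
  have c1 : Real.cos (Real.pi / 12) = Real.sqrt 2 * (1 + Real.sqrt 3) / 4 := by
    rw [show Real.pi / 12 = Real.pi / 3 - Real.pi / 4 by ring, Real.cos_sub, Real.cos_pi_div_three,
      Real.cos_pi_div_four, Real.sin_pi_div_three, Real.sin_pi_div_four]
    ring
  have c7 : Real.cos (Real.pi / 3 + Real.pi / 4) = Real.sqrt 2 * (1 - Real.sqrt 3) / 4 := by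
    rw [Real.cos_add, Real.cos_pi_div_three,
      Real.cos_pi_div_four, Real.sin_pi_div_three, Real.sin_pi_div_four]
    ring
  unfold cosBound
  split
  · rw [show ((1 : ℕ) : ℝ) * Real.pi / 12 = Real.pi / 12 by push_cast; ring, c1]
    push_cast
    nlinarith
  · rw [show ((2 : ℕ) : ℝ) * Real.pi / 12 = Real.pi / 6 by push_cast; ring, Real.cos_pi_div_six]
    push_cast
    linarith
  · rw [show ((3 : ℕ) : ℝ) * Real.pi / 12 = Real.pi / 4 by push_cast; ring, Real.cos_pi_div_four]
    push_cast
    linarith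
  · rw [show ((5 : ℕ) : ℝ) * Real.pi / 12 = Real.pi - (Real.pi / 3 + Real.pi / 4) by
      push_cast; ring, Real.cos_pi_sub, c7]
    push_cast
    nlinarith
  · rw [show ((7 : ℕ) : ℝ) * Real.pi / 12 = Real.pi / 3 + Real.pi / 4 by push_cast; ring, c7]
    push_cast
    nlinarith
  · rw [show ((9 : ℕ) : ℝ) * Real.pi / 12 = Real.pi - Real.pi / 4 by push_cast; ring,
      Real.cos_pi_sub, Real.cos_pi_div_four]
    push_cast
    linarith
  · rw [show ((10 : ℕ) : ℝ) * Real.pi / 12 = Real.pi - Real.pi / 6 by push_cast; ring,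
      Real.cos_pi_sub, Real.cos_pi_div_six]
    push_cast
    linarith
  -- The default value corresponds to the trivial bound `-1`, valid for every `k`.
  · push_cast
    linarith [Real.neg_one_le_cos (k * Real.pi / 12)]

/-- The map `t ↦ t * |t|` is a sign-preserving square. It allows cosines, whose denominators contain
square roots, to be compared through integers. -/
theorem lt_of_mul_abs_lt {a b : ℝ} (h : a * |a| < b * |b|) : a < b := by
  by_contra! hab
  rcases le_total 0 a with ha | ha <;> rcases le_total 0 b with hb | hb <;>
    simp only [abs_of_nonneg, abs_of_nonpos, ha, hb] at h <;> nlinarith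

/-- Integer inequalities which ensure that the angle at `vertex j` of the triangle with vertices
`i`, `j`, `l` is greater than `k * π / 12` and less than `π`. -/
abbrev AngleBound (i j l : Fin 20) (k : ℕ) : Prop :=
  0 < dotAt i j i ∧ 0 < dotAt l j l ∧ dotAt i j l * dotAt i j l < dotAt i j i * dotAt l j l ∧
    dotAt i j l * |dotAt i j l| * 100000 ^ 2 <
      cosBound k * |cosBound k| * (dotAt i j i * dotAt l j l)

theorem AngleBound.lt_angle {i j l : Fin 20} {k : ℕ} (h : AngleBound i j l k) (hk : k ≤ 12) :
    k * Real.pi / 12 < EuclideanGeometry.angle (vertex i) (vertex j) (vertex l) := by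
  obtain ⟨h1, h2, -, h3⟩ := h
  have n1 : ‖vertex i - vertex j‖ ^ 2 = dotAt i j i := by rw [← dist_eq_norm, dist_vertex_sq]
  have n2 : ‖vertex l - vertex j‖ ^ 2 = dotAt l j l := by rw [← dist_eq_norm, dist_vertex_sq]
  have h1' : (0 : ℝ) < dotAt i j i := by exact_mod_cast h1
  have h2' : (0 : ℝ) < dotAt l j l := by exact_mod_cast h2
  have h3' : (dotAt i j l : ℝ) * |(dotAt i j l : ℝ)| * 100000 ^ 2 <
      cosBound k * |(cosBound k : ℝ)| * (dotAt i j i * dotAt l j l) := by exact_mod_cast h3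
  set D := ‖vertex i - vertex j‖ * ‖vertex l - vertex j‖ with hD
  have hD2 : D ^ 2 = dotAt i j i * dotAt l j l := by rw [hD, mul_pow, n1, n2]
  have hD0 : 0 < D := by
    refine lt_of_le_of_ne (by positivity) fun h0 => ?_
    rw [← h0] at hD2
    nlinarith [mul_pos h1' h2']
  have key : (dotAt i j l : ℝ) / D < cosBound k / 100000 := by
    apply lt_of_mul_abs_lt
    rw [abs_div, abs_div, abs_of_pos hD0, div_mul_div_comm, div_mul_div_comm,
      div_lt_div_iff₀ (by positivity) (by positivity), ← sq, hD2,
      abs_of_pos (by norm_num : (0 : ℝ) < 100000)]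
    linarith [h3']
  have hx := key.trans_le (cosBound_le k)
  rw [EuclideanGeometry.angle, InnerProductGeometry.angle, vsub_eq_sub, vsub_eq_sub, inner_vertex,
    ← hD]
  have hk' : (k : ℝ) ≤ 12 := by exact_mod_cast hk
  have hle : k * Real.pi / 12 ≤ Real.pi := by nlinarith [Real.pi_pos]
  rw [← Real.arccos_cos (x := k * Real.pi / 12) (by positivity) hle]
  refine Real.strictAntiOn_arccos ⟨?_, ?_⟩ ⟨Real.neg_one_le_cos _, Real.cos_le_one _⟩ hx
  · rw [hD, ← inner_vertex]
    exact (abs_le.1 (abs_real_inner_div_norm_mul_norm_le_one _ _)).1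
  · rw [hD, ← inner_vertex]
    exact (abs_le.1 (abs_real_inner_div_norm_mul_norm_le_one _ _)).2

theorem AngleBound.angle_lt_pi {i j l : Fin 20} {k : ℕ} (h : AngleBound i j l k) :
    EuclideanGeometry.angle (vertex i) (vertex j) (vertex l) < Real.pi := by
  refine lt_of_le_of_ne (EuclideanGeometry.angle_le_pi _ _ _) fun hpi => ?_
  have := InnerProductGeometry.inner_eq_neg_mul_norm_of_angle_eq_pi hpi
  rw [vsub_eq_sub, vsub_eq_sub, inner_vertex] at this
  have n1 : ‖vertex i - vertex j‖ ^ 2 = dotAt i j i := by rw [← dist_eq_norm, dist_vertex_sq]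
  have n2 : ‖vertex l - vertex j‖ ^ 2 = dotAt l j l := by rw [← dist_eq_norm, dist_vertex_sq]
  have h3 : (dotAt i j l : ℝ) * dotAt i j l < dotAt i j i * dotAt l j l := by
    exact_mod_cast h.2.2.1
  rw [this, ← n1, ← n2] at h3
  nlinarith

theorem AngleBound.ne_left {i j l : Fin 20} {k : ℕ} (h : AngleBound i j l k) :
    vertex i ≠ vertex j := by
  intro e
  have := h.1
  rw [vertex.injective e] at this
  simp [dotAt] at this

theorem AngleBound.ne_right {i j l : Fin 20} {k : ℕ} (h : AngleBound i j l k) :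
    vertex l ≠ vertex j := by
  intro e
  have := h.2.1
  rw [vertex.injective e] at this
  simp [dotAt] at this

/-- The two vertices of the hat triangle `i` other than `u`. -/
def corner (u : Fin 7) (i : Fin 9) : Fin 7 × Fin 7 :=
  if (hatTriangle i).1 = u then ((hatTriangle i).2.1, (hatTriangle i).2.2)
  else if (hatTriangle i).2.1 = u then ((hatTriangle i).1, (hatTriangle i).2.2)
  else ((hatTriangle i).1, (hatTriangle i).2.1)

/-- The triangles of a hat at the vertex `u`, except for the triangle `T`. -/
def fan (u : Fin 7) (T : Fin 9) : Finset (Fin 9) :=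
  {i | ((hatTriangle i).1 = u ∨ (hatTriangle i).2.1 = u ∨ (hatTriangle i).2.2 = u) ∧ i ≠ T}

/-- Lower bounds for the angles at `x`, `y` and `z`, as multiples of `π / 12`. -/
def angleGrid (u : Fin 7) (i : Fin 9) : ℕ :=
  -- Zeros mark triangles that do not contain `u`. Each row sums to 29 with both crown entries equal
  -- to 5, so omitting either crown triangle leaves 24, that is, a full turn.
  if u = 3 then ![10, 5, 0, 3, 0, 1, 5, 0, 5] i
  else if u = 4 then ![0, 0, 10, 7, 2, 0, 5, 5, 0] i
  else ![0, 0, 0, 0, 9, 10, 0, 5, 5] i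

/-- The vertices `x`, `y`, `z`, each with one of its two crown triangles. -/
def crownCorners : List (Fin 7 × Fin 9) := [(3, 6), (3, 8), (4, 6), (4, 7), (5, 7), (5, 8)]

theorem sum_angleGrid : ∀ c ∈ crownCorners, 24 ≤ ∑ i ∈ fan c.1 c.2, angleGrid c.1 i := by
  decide +kernel

theorem angleBound_fan : ∀ h : Fin 4, ∀ c ∈ crownCorners, ∀ i ∈ fan c.1 c.2,
    AngleBound (Scheme.hatVertex h (corner c.1 i).1) (Scheme.hatVertex h c.1)
      (Scheme.hatVertex h (corner c.1 i).2) (angleGrid c.1 i) ∧ angleGrid c.1 i ≤ 12 ∧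
    hatFace h i = {Scheme.hatVertex h c.1, Scheme.hatVertex h (corner c.1 i).1,
      Scheme.hatVertex h (corner c.1 i).2} := by
  decide +kernel

theorem hatFace_injective : Function.Injective fun x : Fin 4 × Fin 9 => hatFace x.1 x.2 := by
  decide +kernel

/-- The triangle `i` of the hat `h`, as a face in space. -/
noncomputable def hatFace3 (h : Fin 4) (i : Fin 9) : Finset E3 := (hatFace h i).map vertex

theorem hatFace3_injective : Function.Injective fun x : Fin 4 × Fin 9 => hatFace3 x.1 x.2 :=
  (Finset.map_injective vertex).comp hatFace_injective

theorem mem_faces_hatted {t : Finset E3} :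
    t ∈ (Scheme.hatted 4).toPolyhedron.faces ↔ ∃ h i, t = hatFace3 h i := by
  simp only [Scheme.toPolyhedron, realize, hatted_faces, Finset.mem_map, Finset.mem_image,
    Finset.mem_univ, true_and]
  constructor
  · rintro ⟨_, ⟨⟨h, i⟩, rfl⟩, rfl⟩
    exact ⟨h, i, rfl⟩
  · rintro ⟨h, i, rfl⟩
    exact ⟨_, ⟨(h, i), rfl⟩, rfl⟩

/-- In an unfolding of the hatted tetrahedron, the faces at a crown vertex of a hat, without one of
the crown faces, are not all placed around the same point. -/
theorem not_fan_agree {cut : Set (Finset E3)} {place : Finset E3 → E3 →ᵃ[ℝ] E2}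
    (hU : (Scheme.hatted 4).toPolyhedron.IsEdgeUnfolding cut place) (h : Fin 4)
    {c : Fin 7 × Fin 9} (hc : c ∈ crownCorners) :
    ¬ ∀ i ∈ fan c.1 c.2, ∀ j ∈ fan c.1 c.2,
      place (hatFace3 h i) (vertex (Scheme.hatVertex h c.1)) =
        place (hatFace3 h j) (vertex (Scheme.hatVertex h c.1)) := by
  intro hagree
  have hb := angleBound_fan h c hc
  have hsum := hU.sum_angle_le (fan c.1 c.2) (hatFace3 h) (vertex (Scheme.hatVertex h c.1))
    (fun i => vertex (Scheme.hatVertex h (corner c.1 i).1))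
    (fun i => vertex (Scheme.hatVertex h (corner c.1 i).2))
    (fun i _ => mem_faces_hatted.2 ⟨h, i, rfl⟩)
    (fun i hi => by
      rw [hatFace3, (hb i hi).2.2]
      simp)
    (fun i _ j _ hij => (Prod.ext_iff.1 (hatFace3_injective (a₁ := (h, i)) (a₂ := (h, j)) hij)).2)
    (fun i hi => (hb i hi).1.ne_left) (fun i hi => (hb i hi).1.ne_right)
    (fun i hi => lt_of_le_of_lt (by positivity) ((hb i hi).1.lt_angle (hb i hi).2.1))
    (fun i hi => (hb i hi).1.angle_lt_pi) hagree
  have hg := sum_angleGrid c hc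
  have hne : (fan c.1 c.2).Nonempty := by
    by_contra hne
    rw [Finset.not_nonempty_iff_eq_empty.1 hne] at hg
    simp at hg
  -- Every single bound is strict, so a grid sum of exactly 24 already gives more than `2π`.
  have hlt := Finset.sum_lt_sum_of_nonempty hne fun i hi =>
    (hb i hi).1.lt_angle (hb i hi).2.1
  rw [← Finset.sum_div, ← Finset.sum_mul, ← Nat.cast_sum] at hlt
  have hg' : (24 : ℝ) ≤ (∑ i ∈ fan c.1 c.2, angleGrid c.1 i : ℕ) := by exact_mod_cast hg
  nlinarith [Real.pi_pos]

/-! ### The cuts separate each hat. -/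

/-- The pairs of adjacent triangles within a hat. -/
def hatEdge : Fin 12 → Fin 9 × Fin 9 :=
  ![(0, 3), (0, 1), (1, 5), (2, 3), (2, 4), (3, 6), (4, 5), (4, 7), (5, 8), (6, 8), (6, 7), (7, 8)]

theorem exists_hatEdge : ∀ h : Fin 4, ∀ i j : Fin 9, (hatFace h i ∩ hatFace h j).card = 2 →
    ∃ e, hatEdge e = (i, j) ∨ hatEdge e = (j, i) := by
  decide +kernel

/-- Sets of hat edges at a crown vertex `u` that connect all the triangles in `fan u T`. -/
def fanArcs : List (Fin 7 × Fin 9 × List (Fin 12)) :=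
  -- In cyclic order the edges at `x` are 0, 5, 9, 8, 2, 1, those at `y` are 3, 5, 10, 7, 4, and
  -- those at `z` are 6, 8, 11, 7. An arc arises by deleting one edge, or both sides at `u` of one
  -- crown triangle; only minimal arcs are listed. The arcs with one edge deleted run through the
  -- omitted triangle.
  [(3, 6, [1, 2, 8, 9, 5]), (3, 6, [0, 2, 8, 9, 5]), (3, 6, [0, 1, 8, 9, 5]), (3, 6, [0, 1, 2, 8]),
    (3, 8, [0, 1, 2, 5]), (4, 6, [5, 10, 7, 4]), (4, 6, [3, 7, 4]), (4, 6, [3, 5, 10, 7]),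
    (4, 7, [3, 5, 4]), (5, 8, [8, 11, 7]), (5, 8, [6, 7]), (5, 7, [6, 8])]

theorem fanArcs_spec : ∀ h : Fin 4, ∀ c ∈ fanArcs, (c.1, c.2.1) ∈ crownCorners ∧
    ∀ e ∈ c.2.2, Scheme.hatVertex h c.1 ∈ hatFace h (hatEdge e).1 ∩ hatFace h (hatEdge e).2 ∧
      (hatFace h (hatEdge e).1 ∩ hatFace h (hatEdge e).2).card = 2 := by
  decide +kernel

/-- Applied with `A i` the planar position of the crown vertex in triangle `i`: an uncut arc keeps
all these positions equal, which the angle sum forbids. -/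
theorem fan_agree_of_arc {α : Type*} (A : Fin 9 → α) : ∀ c ∈ fanArcs,
    (∀ e ∈ c.2.2, A (hatEdge e).1 = A (hatEdge e).2) →
      ∀ i ∈ fan c.1 c.2.1, ∀ j ∈ fan c.1 c.2.1, A i = A j := by
  intro c hc hA
  suffices H : ∃ a, ∀ i ∈ fan c.1 c.2.1, A i = a by
    obtain ⟨a, ha⟩ := H
    exact fun i hi j hj => (ha i hi).trans (ha j hj).symm
  have f36 : fan 3 6 = {0, 1, 3, 5, 8} := by decide
  have f38 : fan 3 8 = {0, 1, 3, 5, 6} := by decide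
  have f46 : fan 4 6 = {2, 3, 4, 7} := by decide
  have f47 : fan 4 7 = {2, 3, 4, 6} := by decide
  have f57 : fan 5 7 = {4, 5, 8} := by decide
  have f58 : fan 5 8 = {4, 5, 7} := by decide
  simp only [fanArcs, List.mem_cons, List.not_mem_nil, or_false] at hc
  rcases hc with rfl | rfl | rfl | rfl | rfl | rfl | rfl | rfl | rfl | rfl | rfl | rfl <;>
    simp [hatEdge, f36, f38, f46, f47, f57, f58] at hA ⊢ <;>
    grind

/-- Sets of triangles of a hat, encoded in binary, each with the list of its boundary edges in the
interior of the hat. -/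
def hatSides : List (ℕ × List (Fin 12)) :=
  [(63, [5, 7, 8]), (4, [3, 4]), (32, [2, 6, 8]), (16, [4, 6, 7]), (20, [3, 6, 7]),
    (34, [1, 6, 8]), (35, [0, 6, 8]), (144, [4, 6, 10, 11]), (148, [3, 6, 10, 11]),
    (28, [0, 5, 6, 7]), (29, [1, 5, 6, 7]), (31, [2, 5, 6, 7]), (43, [3, 5, 6, 8]),
    (47, [4, 5, 6, 8]), (48, [2, 4, 7, 8]), (50, [1, 4, 7, 8]), (51, [0, 4, 7, 8]),
    (52, [2, 3, 7, 8]), (54, [1, 3, 7, 8]), (55, [0, 3, 7, 8]), (8, [0, 3, 5]), (9, [1, 3, 5]),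
    (11, [2, 3, 5]), (12, [0, 4, 5]), (13, [1, 4, 5]), (15, [2, 4, 5])]

theorem hatSides_spec : ∀ s ∈ hatSides, (∃ i j : Fin 9, s.1.testBit i ≠ s.1.testBit j) ∧
    ∀ e, e ∉ s.2 → s.1.testBit (hatEdge e).1 = s.1.testBit (hatEdge e).2 := by
  decide +kernel

/-- If the cut edges of a hat, encoded in binary, meet all the sets of edges in `fanArcs`, then they
separate the hat. -/
def sideOrArc (b : ℕ) : Bool :=
  (fanArcs.any fun c => c.2.2.all fun e => !b.testBit e) ||
    hatSides.any fun s => s.2.all fun e => b.testBit e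

theorem sideOrArc_eq_true {b : ℕ} (hb : b < 4096) : sideOrArc b = true := by
  -- The twelve bits are split into two halves of six.
  have key : ∀ q r : Fin 64, sideOrArc (64 * q + r) = true := by decide +kernel
  have h := key ⟨b / 64, by omega⟩ ⟨b % 64, by omega⟩
  rwa [show 64 * (b / 64) + b % 64 = b by omega] at h

section Unfolding
variable {cut : Set (Finset E3)} {place : Finset E3 → E3 →ᵃ[ℝ] E2}

open scoped Classical in
theorem adjFaces_hatted {h h' : Fin 4} {i j : Fin 9} :
    (Scheme.hatted 4).toPolyhedron.AdjFaces (hatFace3 h i) (hatFace3 h' j) ↔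
      (hatFace h i ∩ hatFace h' j).card = 2 := by
  have hc : (hatFace3 h i ∩ hatFace3 h' j).card = (hatFace h i ∩ hatFace h' j).card := by
    rw [hatFace3, hatFace3, ← Finset.card_map vertex, Finset.map_inter]
  rw [TriPolyhedron.AdjFaces, hc]
  exact ⟨fun H => H.2.2, fun H =>
    ⟨mem_faces_hatted.2 ⟨h, i, rfl⟩, mem_faces_hatted.2 ⟨h', j, rfl⟩, H⟩⟩

open scoped Classical in
/-- In an unfolding, each hat is separated by the cuts in its interior. -/
theorem exists_hat_coloring
    (hU : (Scheme.hatted 4).toPolyhedron.IsEdgeUnfolding cut place) (h : Fin 4) :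
    ∃ f : Fin 9 → Bool, (∃ i j, f i ≠ f j) ∧ ∀ i j, (hatFace h i ∩ hatFace h j).card = 2 →
      hatFace3 h i ∩ hatFace3 h j ∉ cut → f i = f j := by
  let b : ℕ := Nat.ofBits fun e : Fin 12 =>
    decide (hatFace3 h (hatEdge e).1 ∩ hatFace3 h (hatEdge e).2 ∈ cut)
  have hb : ∀ e : Fin 12, b.testBit e =
      decide (hatFace3 h (hatEdge e).1 ∩ hatFace3 h (hatEdge e).2 ∈ cut) := fun e => by
    simp [b, Nat.testBit_ofBits_lt]
  have hsa := sideOrArc_eq_true (b := b) (Nat.ofBits_lt_two_pow _)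
  simp only [sideOrArc, Bool.or_eq_true, List.any_eq_true, List.all_eq_true,
    Bool.not_eq_true'] at hsa
  rcases hsa with ⟨c, hc, hcb⟩ | ⟨s, hs, hsb⟩
  · obtain ⟨hcc, hce⟩ := fanArcs_spec h c hc
    refine absurd ?_ (not_fan_agree hU h hcc)
    refine fan_agree_of_arc
      (fun i => place (hatFace3 h i) (vertex (Scheme.hatVertex h c.1))) c hc fun e he => ?_
    obtain ⟨hv, hcard⟩ := hce e he
    refine hU.attached _ _ (adjFaces_hatted.2 hcard) ?_ _ (subset_convexHull ℝ _ ?_)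
    · have := hcb e he
      rw [hb] at this
      exact of_decide_eq_false this
    · rw [hatFace3, hatFace3, ← Finset.map_inter]
      exact Finset.mem_map_of_mem _ hv
  -- All boundary edges of this set of triangles are cut, so its indicator is the required coloring.
  · refine ⟨fun i => s.1.testBit i, (hatSides_spec s hs).1, fun i j hij hcut => ?_⟩
    have hse : ∀ e, hatFace3 h (hatEdge e).1 ∩ hatFace3 h (hatEdge e).2 ∉ cut →
        s.1.testBit (hatEdge e).1 = s.1.testBit (hatEdge e).2 := fun e he =>
      (hatSides_spec s hs).2 e fun hes => he (by simpa [hb] using hsb e hes)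
    obtain ⟨e, he | he⟩ := exists_hatEdge h i j hij
    · have := hse e (by rwa [he])
      rwa [he] at this
    · have := hse e (by rwa [he, Finset.inter_comm])
      rw [he] at this
      exact this.symm

/-! ### Combining the four hats. -/

/-- The six edges of the tetrahedron: the two hats at the edge, and the triangle of each of them
that contains it. -/
def crossEdge : Fin 6 → Fin 4 × Fin 4 × Fin 9 :=
  ![(0, 2, 0), (1, 3, 0), (0, 3, 1), (1, 2, 1), (0, 1, 2), (2, 3, 2)]

/-- The half-turn that swaps two hats preserves their common edge, so the triangles on its two sides
carry the same label. -/
theorem exists_crossEdge : ∀ h h' : Fin 4, ∀ i j : Fin 9, h ≠ h' →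
    (hatFace h i ∩ hatFace h' j).card = 2 →
    i = j ∧ ∃ e, crossEdge e = (h, h', i) ∨ crossEdge e = (h', h, i) := by
  decide +kernel

/-- Nonconstant colorings of the four hats can be combined into a nonconstant coloring that agrees
across the six edges of the tetrahedron. -/
theorem exists_global_coloring (f : Fin 4 → Fin 9 → ℚ) (hf : ∀ h, ∃ i j, f h i ≠ f h j) :
    ∃ α β : Fin 4 → ℚ, (∀ e, α (crossEdge e).1 + β (crossEdge e).1 *
        f (crossEdge e).1 (crossEdge e).2.2 =
      α (crossEdge e).2.1 + β (crossEdge e).2.1 * f (crossEdge e).2.1 (crossEdge e).2.2) ∧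
    ∃ h i h' i', α h + β h * f h i ≠ α h' + β h' * f h' i' := by
  -- Eight unknowns meet seven equations: one for each edge, and the normalization `α 0 = 0`, which
  -- rules out nonzero constant colorings.
  let L : ((Fin 4 → ℚ) × (Fin 4 → ℚ)) →ₗ[ℚ] (Fin 6 → ℚ) × ℚ :=
    { toFun := fun v => (fun e => v.1 (crossEdge e).1 + v.2 (crossEdge e).1 *
          f (crossEdge e).1 (crossEdge e).2.2 -
        (v.1 (crossEdge e).2.1 + v.2 (crossEdge e).2.1 *
          f (crossEdge e).2.1 (crossEdge e).2.2), v.1 0)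
      map_add' := fun v w => by
        refine Prod.ext (funext fun e => ?_) rfl
        simp only [Prod.fst_add, Prod.snd_add, Pi.add_apply]
        ring
      map_smul' := fun r v => by
        refine Prod.ext (funext fun e => ?_) rfl
        simp only [Prod.smul_fst, Prod.smul_snd, Pi.smul_apply, smul_eq_mul, RingHom.id_apply]
        ring }
  have hker : LinearMap.ker L ≠ ⊥ := LinearMap.ker_ne_bot_of_finrank_lt (by simp)
  obtain ⟨⟨α, β⟩, hv, hne⟩ := Submodule.exists_mem_ne_zero_of_ne_bot hker
  have hL : L (α, β) = 0 := hv
  refine ⟨α, β, fun e => sub_eq_zero.1 (congrFun (congrArg Prod.fst hL) e), ?_⟩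
  by_contra! hconst
  have h0 : α 0 = 0 := congrArg Prod.snd hL
  -- A constant combination of nonconstant `f h` has zero slopes; then all `α h` equal `α 0 = 0`,
  -- contradicting the choice of a nonzero kernel vector.
  have hβ : ∀ h, β h = 0 := fun h => by
    obtain ⟨i, j, hij⟩ := hf h
    have := hconst h i h j
    have h2 : β h * (f h i - f h j) = 0 := by linarith
    exact (mul_eq_zero.1 h2).resolve_right (sub_ne_zero.2 hij)
  apply hne
  refine Prod.ext (funext fun h => ?_) (funext hβ)
  have := hconst h 0 0 0
  simpa [hβ, h0] using this

/-- The combined coloring `g` is constant along every chain of faces crossing uncut edges, yet takes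
two values. It agrees across all six tetrahedron edges, so it does not matter which of these are
cut. -/
theorem not_isEdgeUnfolding_hatted :
    ¬ (Scheme.hatted 4).toPolyhedron.IsEdgeUnfolding cut place := by
  classical
  intro hU
  choose f hf hfu using exists_hat_coloring hU
  obtain ⟨α, β, hcross, h₀, i₀, h₁, i₁, hne⟩ :=
    exists_global_coloring (fun h i => if f h i then 1 else 0) fun h => by
      obtain ⟨i, j, hij⟩ := hf h
      refine ⟨i, j, ?_⟩
      cases hi : f h i <;> cases hj : f h j <;> simp_all
  set g : Fin 4 → Fin 9 → ℚ := fun h i => α h + β h * if f h i then 1 else 0 with hg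
  have hconn := hU.connected _ (mem_faces_hatted.2 ⟨h₀, i₀, rfl⟩) _
    (mem_faces_hatted.2 ⟨h₁, i₁, rfl⟩)
  have key : ∀ t, Relation.ReflTransGen (fun s' t' =>
      (Scheme.hatted 4).toPolyhedron.AdjFaces s' t' ∧ s' ∩ t' ∉ cut) (hatFace3 h₀ i₀) t →
      ∀ h i, t = hatFace3 h i → g h₀ i₀ = g h i := by
    intro t ht
    induction ht with
    | refl =>
      intro h i e
      have := hatFace3_injective (a₁ := (h₀, i₀)) (a₂ := (h, i)) e
      rw [Prod.mk.injEq] at this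
      rw [this.1, this.2]
    | tail _ hst ih =>
      rename_i s t
      intro h i e
      obtain ⟨h', i', rfl⟩ := mem_faces_hatted.1 hst.1.1
      subst e
      rw [ih h' i' rfl]
      have hcard := adjFaces_hatted.1 hst.1
      by_cases hh : h' = h
      · subst hh
        simp only [hg]
        rw [hfu h' i' i hcard (by convert hst.2)]
      · obtain ⟨rfl, e, he | he⟩ := exists_crossEdge h' h i' i hh hcard
        · have := hcross e
          rwa [he] at this
        · have := hcross e
          rw [he] at this
          exact this.symm
  exact hne (key _ hconn h₁ i₁ rfl)

end Unfolding

theorem mainTheorem2 :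
    ∃ P : TriPolyhedron, P.IsStacked ∧ P.NoFlatEdges ∧ IsHattedTetrahedron P ∧
      ¬ P.HasEdgeUnfolding :=
  ⟨(Scheme.hatted 4).toPolyhedron, (Scheme.good_hatted 4 le_rfl).isStacked, noFlatEdges_hatted,
    Scheme.isHattedTetrahedron_hatted, fun ⟨_, _, hU⟩ => not_isEdgeUnfolding_hatted hU⟩
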